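/- Let $p$ be a prime, let $F$ be a field of characteristic $p$, and let $\lambda=(\lambda_1\ge\lambda_2\ge\cdots)$ be a partition of $n$ (missing parts being $0$). Let $S^\lambda$ be the Specht module over $F$, that is, the $FS_n$-submodule of the Young permutation module $M^\lambda$ (with basis the $\lambda$-tabloids) spanned by the polytabloids $e_t=\sum_{g\in C(t)}\operatorname{sgn}(g)\,g\mathbf{t}$, where $t$ runs over the $\lambda$-tableaux, $\mathbf{t}$ is the tabloid of $t$ and $C(t)$ is the column stabiliser of $t$. For a finite group $G$ and an indecomposable $FG$-module $M$, a subgroup $Q\le G$ is a vertex of $M$ if there is an indecomposable $FQ$-module $N$ such that $M$ is isomorphic to a direct summand of the induced module $N\!\uparrow_Q^G$, and $Q$ is minimal with this property; all modules are finite-dimensional. If $S^\lambda$ is indecomposable, then it has a vertex containing a Sylow $p$-subgroup of $S_{\lambda_1-\lambda_2}$. Precisely: for every subset $A\subseteq\{1,\dots,n\}$ with $|A|=\lambda_1-\lambda_2$ and every Sylow $p$-subgroup $P$ of the symmetric group on $A$, regarded as the subgroup of $S_n$ of permutations fixing every point outside $A$, there is a vertex $Q$ of $S^\lambda$ with $P\le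 Q$. -/

import Mathlib

universe u v w

/-! ### Vertices of modules for finite groups

Modules for the group algebra `FG` are given as representations `Representation F G V`. -/

namespace GreenVertex

variable {F : Type u} [Field F] {G : Type v} [Group G]

/-- An `FG`-module is indecomposable if it is nonzero and is not the direct sum of two nonzero
submodules. -/
def IsIndecomposable {V : Type w} [AddCommGroup V] [Module F V]
    (ρ : Representation F G V) : Prop :=
  Nontrivial V ∧ ∀ W₁ W₂ : Subrepresentation ρ, IsCompl W₁ W₂ → W₁ = ⊥ ∨ W₂ = ⊥

/-- `ρ` is (isomorphic to) a direct summand of `τ`: there are `FG`-homomorphisms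
`i : V → W` and `r : W → V` with `r ∘ i = id`. -/
def IsSummand {V : Type*} {W : Type*} [AddCommGroup V] [Module F V] [AddCommGroup W] [Module F W]
    (ρ : Representation F G V) (τ : Representation F G W) : Prop :=
  ∃ (i : Representation.IntertwiningMap ρ τ) (r : Representation.IntertwiningMap τ ρ),
    ∀ x : V, r (i x) = x

/-- There is a (finite-dimensional) indecomposable `FQ`-module `N` such that the `FG`-module `V`
is a summand of the module induced from `N` to `G`. (Up to isomorphism, every finite-dimensional
`FQ`-module lives in the universe of `F`.) -/
def IsSummandOfInduced {V : Type w} [AddCommGroup V] [Module F V]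
    (ρ : Representation F G V) (Q : Subgroup G) : Prop :=
  ∃ (N : Type u) (_ : AddCommGroup N) (_ : Module F N) (σ : Representation F Q N),
    Module.Finite F N ∧ IsIndecomposable σ ∧ IsSummand ρ (Representation.ind Q.subtype σ)

/-- `Q` is a vertex of the `FG`-module `V`: it is minimal, for inclusion, among the subgroups `Q`
of `G` such that `V` is a summand of a module induced from an indecomposable `FQ`-module. -/
def IsVertex {V : Type w} [AddCommGroup V] [Module F V]
    (ρ : Representation F G V) (Q : Subgroup G) : Prop :=
  Minimal (IsSummandOfInduced ρ) Q

end GreenVertex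

/-! ### Specht modules

A partition `lam` of `n` is a Young diagram with `n = lam.card` boxes; its parts are
`lam.rowLen 0 ≥ lam.rowLen 1 ≥ ⋯`. The set permuted by the symmetric group is `Fin n`.
A box `(i, j)` is in row `i` and column `j`. -/

namespace SpechtModule

/-- A tableau: a bijective assignment of the elements of `Fin n` to the boxes. -/
def Tableau (lam : YoungDiagram) : Type := lam.cells ≃ Fin lam.card

variable {lam : YoungDiagram}

/-- The row of the tableau `t` that contains `a`. -/
def Tableau.row (t : Tableau lam) (a : Fin lam.card) : ℕ := (Equiv.symm t a).1.1

/-- The column of the tableau `t` that contains `a`. -/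
def Tableau.col (t : Tableau lam) (a : Fin lam.card) : ℕ := (Equiv.symm t a).1.2

/-- A permutation `g` acts on tableaux by replacing each entry `a` by `g a`. -/
instance : MulAction (Equiv.Perm (Fin lam.card)) (Tableau lam) where
  smul g t := Equiv.trans t g
  one_smul _ := rfl
  mul_smul _ _ _ := rfl

theorem row_smul (g : Equiv.Perm (Fin lam.card)) (t : Tableau lam) (a : Fin lam.card) :
    (g • t).row a = t.row (g⁻¹ a) := rfl

theorem col_smul (g : Equiv.Perm (Fin lam.card)) (t : Tableau lam) (a : Fin lam.card) :
    (g • t).col a = t.col (g⁻¹ a) := rfl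

/-- Two tableaux are row equivalent if they have the same entries in each row, that is, if
each `a` is in the same row of both. -/
def rowSetoid (lam : YoungDiagram) : Setoid (Tableau lam) := Setoid.ker Tableau.row

/-- A tabloid: a tableau up to the order of the entries within the rows. -/
def Tabloid (lam : YoungDiagram) : Type := Quotient (rowSetoid lam)

/-- The tabloid of a tableau. -/
def Tableau.tabloid (t : Tableau lam) : Tabloid lam := Quotient.mk (rowSetoid lam) t

/-- The action on tabloids induced by the action on tableaux. -/
instance : MulAction (Equiv.Perm (Fin lam.card)) (Tabloid lam) where
  smul g := Quotient.map (g • ·) fun s t (h : s.row = t.row) =>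
    funext fun a => congrFun h (g⁻¹ a)
  one_smul x := Quotient.inductionOn x fun _ => rfl
  mul_smul _ _ x := Quotient.inductionOn x fun _ => rfl

theorem smul_tabloid (g : Equiv.Perm (Fin lam.card)) (t : Tableau lam) :
    g • t.tabloid = (g • t).tabloid := rfl

/-- The column stabiliser `C(t)`: the permutations that fix each column of `t` setwise. -/
def colStabilizer (t : Tableau lam) : Subgroup (Equiv.Perm (Fin lam.card)) where
  carrier := {g | ∀ a, t.col (g a) = t.col a}
  one_mem' _ := rfl
  mul_mem' {g h} hg hh a := (hg (h a)).trans (hh a)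
  inv_mem' {g} hg a := by simpa using (hg (g⁻¹ a)).symm

theorem mem_colStabilizer {t : Tableau lam} {g : Equiv.Perm (Fin lam.card)} :
    g ∈ colStabilizer t ↔ ∀ a, t.col (g a) = t.col a := Iff.rfl

instance (t : Tableau lam) : DecidablePred (· ∈ colStabilizer t) := fun _ =>
  decidable_of_iff _ mem_colStabilizer.symm

variable (F : Type u) [Field F]

/-- The Young permutation module `M^lam`: the permutation representation with basis
the set of tabloids. -/
noncomputable abbrev youngPermRep (lam : YoungDiagram) :
    Representation F (Equiv.Perm (Fin lam.card)) (MonoidAlgebra F (Tabloid lam)) :=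
  Representation.ofMulAction F (Equiv.Perm (Fin lam.card)) (Tabloid lam)

/-- The polytabloid `e_t`, the sum over `g ∈ C(t)` of `sgn(g)` times the tabloid of `g • t`. -/
noncomputable def polytabloid (t : Tableau lam) : MonoidAlgebra F (Tabloid lam) :=
  ∑ g : Equiv.Perm (Fin lam.card) with g ∈ colStabilizer t,
    MonoidAlgebra.single (g • t.tabloid) ((Equiv.Perm.sign g : ℤ) : F)

theorem youngPermRep_polytabloid (h : Equiv.Perm (Fin lam.card)) (t : Tableau lam) :
    youngPermRep F lam h (polytabloid F t) = polytabloid F (h • t) := by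
  unfold polytabloid
  rw [map_sum]
  refine Finset.sum_bij (fun g _ => h * g * h⁻¹) ?_ ?_ ?_ ?_
  · intro g hg
    simp only [Finset.mem_filter, Finset.mem_univ, true_and, mem_colStabilizer] at hg ⊢
    intro a
    simpa [col_smul] using hg (h⁻¹ a)
  · intro a _ b _ hab
    simpa using hab
  · intro g hg
    simp only [Finset.mem_filter, Finset.mem_univ, true_and, mem_colStabilizer] at hg
    refine ⟨h⁻¹ * g * h, ?_, by group⟩
    simp only [Finset.mem_filter, Finset.mem_univ, true_and, mem_colStabilizer]
    intro a
    simpa [col_smul] using hg (h a)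
  · intro g _
    have hs : Equiv.Perm.sign (h * g * h⁻¹) = Equiv.Perm.sign g := by
      rw [map_mul, map_mul, map_inv, mul_comm, inv_mul_cancel_left]
    simp only [Representation.ofMulAction_single, ← smul_tabloid, hs, mul_smul, inv_smul_smul]

/-- The Specht module `S^lam`: the submodule of `M^lam` spanned by the polytabloids. -/
noncomputable def specht (lam : YoungDiagram) : Subrepresentation (youngPermRep F lam) where
  toSubmodule := Submodule.span F (Set.range (polytabloid F (lam := lam)))
  apply_mem_toSubmodule h := by
    intro x hx
    induction hx using Submodule.span_induction with
    | mem x hx =>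
      obtain ⟨t, rfl⟩ := hx
      rw [youngPermRep_polytabloid]
      exact Submodule.subset_span ⟨_, rfl⟩
    | zero => simp
    | add x y _ _ hx hy => rw [map_add]; exact add_mem hx hy
    | smul c x _ hx => rw [map_smul]; exact Submodule.smul_mem _ c hx

/-- The Specht module `S^lam` as a representation of the symmetric group. -/
noncomputable abbrev spechtRep (lam : YoungDiagram) :
    Representation F (Equiv.Perm (Fin lam.card)) (specht F lam).toSubmodule :=
  (specht F lam).toRepresentation

end SpechtModule

/-! Choose a tableau `t` whose boxes in columns beyond `lam.rowLen 1` carry exactly the entries of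
`A`; each such box is alone in its column. Permutations of `A` fix the tabloid of `t` and commute
with `C(t)`, so they fix `e_t`. They also preserve the linear form "coefficient at the tabloid of
`t`", whose value at `e_t` is 1. Hence `e_t` spans a trivial direct summand of the Specht module
restricted to `P`.

Such a summand forces `P` into a conjugate of every `Q` for which the module is a summand of one
induced from `Q` (`IsSummandOfInduced.exists_le_conj`). An induced module is a direct sum of blocks
permuted like `G ⧸ Q`, so the value of the form at the vector is a sum over `G ⧸ Q` of terms
constant on `P`-orbits. If `P` fixed no coset, this sum would vanish in characteristic `p`. Finally,
conjugates of vertices are vertices. -/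

/-! ### Maps out of induced modules -/

namespace Representation.IndV

variable {k G H A B : Type*} [CommRing k] [Group G] [Group H] (φ : G →* H)
  [AddCommGroup A] [Module k A] (ρ : Representation k G A) [AddCommGroup B] [Module k B]

theorem mk_map_mul (g : G) (h : H) (a : A) : mk φ ρ (φ g * h) (ρ g a) = mk φ ρ h a := by
  have := Coinvariants.mk_self_apply (Representation.tprod ((leftRegular k H).comp φ) ρ) g
    (MonoidAlgebra.single h 1 ⊗ₜ[k] a)
  simpa using this

variable {φ ρ} in
theorem mk_eq_mk (g : G) {h h' : H} {a a' : A} (hh : h' = φ g * h) (ha : a' = ρ g a) :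
    mk φ ρ h' a' = mk φ ρ h a := by
  rw [hh, ha, mk_map_mul]

/-- A linear map out of an induced module, from its values on the elements `⟦h ⊗ₜ a⟧`. -/
noncomputable def lift (f : H → A →ₗ[k] B) (hf : ∀ g h a, f (φ g * h) (ρ g a) = f h a) :
    IndV φ ρ →ₗ[k] B :=
  Coinvariants.lift _
    (TensorProduct.lift <| (Finsupp.lift _ _ _ f) ∘ₗ
      (MonoidAlgebra.coeffLinearEquiv k).toLinearMap)
    fun g ↦ by
      ext h a
      simp [ofMulAction_single, hf]

variable {φ ρ}

@[simp]
theorem lift_mk (f : H → A →ₗ[k] B) (hf : ∀ g h a, f (φ g * h) (ρ g a) = f h a) (h : H) (a : A) :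
    lift φ ρ f hf (mk φ ρ h a) = f h a := by
  simp [lift]

theorem hom_ext_apply {f g : IndV φ ρ →ₗ[k] B}
    (hfg : ∀ h a, f (mk φ ρ h a) = g (mk φ ρ h a)) : f = g :=
  hom_ext φ ρ fun h => LinearMap.ext (hfg h)

/-- A homomorphism out of an induced module, from its values on the elements `⟦h ⊗ₜ a⟧`. -/
noncomputable def liftHom {τ : Representation k H B} (f : H → A →ₗ[k] B)
    (hf : ∀ g h a, f (φ g * h) (ρ g a) = f h a)
    (hτ : ∀ x h a, f (h * x⁻¹) a = τ x (f h a)) : IntertwiningMap (ind φ ρ) τ :=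
  ⟨lift φ ρ f hf, fun x => hom_ext_apply fun h a => by
    change lift φ ρ f hf (ind φ ρ x (mk φ ρ h a)) = τ x (lift φ ρ f hf (mk φ ρ h a))
    rw [ind_mk, lift_mk, lift_mk, hτ]⟩

theorem liftHom_mk {τ : Representation k H B} (f : H → A →ₗ[k] B)
    (hf : ∀ g h a, f (φ g * h) (ρ g a) = f h a)
    (hτ : ∀ x h a, f (h * x⁻¹) a = τ x (f h a)) (h : H) (a : A) :
    liftHom f hf hτ (mk φ ρ h a) = f h a :=
  lift_mk f hf h a

end Representation.IndV

/-- Each fibre of `c` is `P`-stable without fixed points, so its cardinality is divisible by `p` and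
its contribution vanishes. -/
theorem IsPGroup.sum_eq_zero_of_fixedPoints_eq_empty {p : ℕ} [Fact p.Prime] {P X R : Type*}
    [Group P] (hP : IsPGroup p P) [MulAction P X] [Fintype X] [Ring R] [CharP R p] (c : X → R)
    (hc : ∀ (g : P) (x : X), c (g • x) = c x) (hX : MulAction.fixedPoints P X = ∅) :
    ∑ x, c x = 0 := by
  classical
  have h := Finset.sum_comp (s := Finset.univ) (fun a : R => a) c
  rw [h]
  refine Finset.sum_eq_zero fun b _ => ?_
  let S : SubMulAction P X := ⟨{x | c x = b}, fun g x hx => (hc g x).trans hx⟩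
  have hS : MulAction.fixedPoints P S = ∅ := by
    refine Set.eq_empty_of_forall_notMem fun x hx => ?_
    have : (x : X) ∈ MulAction.fixedPoints P X := fun g => congrArg Subtype.val (hx g)
    simp [hX] at this
  have h1 := hP.card_modEq_card_fixedPoints S
  rw [hS] at h1
  have h2 : Nat.card S = (Finset.univ.filter fun x => c x = b).card :=
    Nat.subtype_card _ fun x => (Finset.mem_filter_univ x).trans Iff.rfl
  have h3 : p ∣ (Finset.univ.filter fun x => c x = b).card := by
    rw [← h2]
    simpa using (Nat.modEq_zero_iff_dvd.1 (by simpa using h1))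
  rw [nsmul_eq_mul, (CharP.cast_eq_zero_iff R p _).2 h3, zero_mul]

/-! ### Relative projectivity and vertices -/

namespace GreenVertex

open Representation

variable {F : Type u} [Field F] {G : Type v} [Group G]

theorem IsIndecomposable.comp {V : Type w} [AddCommGroup V] [Module F V]
    {ρ : Representation F G V} (hρ : IsIndecomposable ρ) {G' : Type*} [Group G'] (f : G' →* G)
    (hf : Function.Surjective f) :
    IsIndecomposable (V := V) (MonoidHom.comp ρ f : Representation F G' V) := by
  refine ⟨hρ.1, fun W₁ W₂ h => ?_⟩
  let T (W : Subrepresentation (MonoidHom.comp ρ f : Representation F G' V)) :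
      Subrepresentation ρ :=
    ⟨W.toSubmodule, fun g v hv => by
      obtain ⟨g', rfl⟩ := hf g
      exact W.apply_mem_toSubmodule g' hv⟩
  have hT : IsCompl (T W₁) (T W₂) := by
    constructor
    · rw [disjoint_iff]
      exact Subrepresentation.toSubmodule_injective
        (congrArg (Subrepresentation.toSubmodule (ρ := MonoidHom.comp ρ f))
          h.disjoint.eq_bot :)
    · rw [codisjoint_iff]
      exact Subrepresentation.toSubmodule_injective
        (congrArg (Subrepresentation.toSubmodule (ρ := MonoidHom.comp ρ f))
          h.codisjoint.eq_top :)
  refine (hρ.2 _ _ hT).imp (fun h => ?_) (fun h => ?_) <;>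
  exact Subrepresentation.toSubmodule_injective
    (congrArg (Subrepresentation.toSubmodule (ρ := ρ)) h :)

/-- This makes the set of candidate subgroups nonempty, so that a minimal one exists. -/
theorem isSummandOfInduced_top {V : Type u} [AddCommGroup V] [Module F V] [Module.Finite F V]
    {ρ : Representation F G V} (hρ : IsIndecomposable ρ) : IsSummandOfInduced ρ ⊤ := by
  let σ : Representation F (⊤ : Subgroup G) V := MonoidHom.comp ρ (Subgroup.subtype ⊤)
  refine ⟨V, inferInstance, inferInstance, σ, inferInstance,
    hρ.comp _ fun g => ⟨⟨g, trivial⟩, rfl⟩, ?_⟩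
  refine ⟨⟨IndV.mk (Subgroup.subtype ⊤) σ 1, fun g => LinearMap.ext fun v => ?_⟩,
    IndV.liftHom (fun h => ρ h⁻¹) (fun g h a => ?_) fun g h a => ?_, fun x => ?_⟩
  · have h := IndV.mk_map_mul (Subgroup.subtype ⊤) σ ⟨g, trivial⟩ g⁻¹ v
    change IndV.mk _ σ 1 (ρ g v) = ind _ σ g (IndV.mk _ σ 1 v)
    rw [ind_mk, one_mul, ← h]
    simp [σ]
  · simp [σ, ← Module.End.mul_apply, ← map_mul]
  · simp
  · exact (IndV.liftHom_mk _ _ _ _ _).trans (by simp)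

theorem IsSummandOfInduced.conj {V : Type w} [AddCommGroup V] [Module F V]
    {ρ : Representation F G V} {Q : Subgroup G} (h : IsSummandOfInduced ρ Q) (g : G) :
    IsSummandOfInduced ρ (Q.map (MulAut.conj g : G ≃* G).toMonoidHom) := by
  obtain ⟨N, _, _, σ, hfin, hσ, i, r, hir⟩ := h
  let e : Q ≃* Q.map (MulAut.conj g : G ≃* G).toMonoidHom := (MulAut.conj g).subgroupMap Q
  let σ' : Representation F (Q.map (MulAut.conj g : G ≃* G).toMonoidHom) N :=
    MonoidHom.comp σ e.symm.toMonoidHom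
  have he (q) : Subgroup.subtype _ q = g * (e.symm q : Q) * g⁻¹ := by
    obtain ⟨q, rfl⟩ := e.surjective q
    simp only [MulEquiv.symm_apply_apply]
    rfl
  have hσ' (q a) : σ' q a = σ (e.symm q) a := rfl
  -- Left translation by `g` commutes with the action of `G`, which is by right translation, and
  -- turns the relations over `Q` into those over its conjugate.
  let a : IntertwiningMap (ind Q.subtype σ) (ind (Subgroup.subtype _) σ') :=
    IndV.liftHom (fun h => IndV.mk _ σ' (g * h))
      (fun q h n => IndV.mk_eq_mk (e q)
        (by rw [he, e.symm_apply_apply, mul_assoc, inv_mul_cancel_left, mul_assoc]; rfl)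
        (by rw [hσ', e.symm_apply_apply]))
      fun x h n => by rw [ind_mk, mul_assoc]
  let b : IntertwiningMap (ind (Subgroup.subtype _) σ') (ind Q.subtype σ) :=
    IndV.liftHom (fun h => IndV.mk _ σ (g⁻¹ * h))
      (fun q h n => IndV.mk_eq_mk (e.symm q)
        (by simp only [he, mul_assoc, inv_mul_cancel_left]; rfl) (hσ' q n))
      fun x h n => by rw [ind_mk, mul_assoc]
  have hba : b.toLinearMap ∘ₗ a.toLinearMap = LinearMap.id :=
    IndV.hom_ext_apply fun h n => by
      change b (a (IndV.mk _ σ h n)) = IndV.mk _ σ h n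
      rw [IndV.liftHom_mk, IndV.liftHom_mk, inv_mul_cancel_left]
  refine ⟨N, inferInstance, inferInstance, σ', hfin, hσ.comp _ e.symm.surjective,
    a.comp i, r.comp b, fun x => ?_⟩
  exact (congrArg r (LinearMap.congr_fun hba (i x))).trans (hir x)

/-- If a `p`-subgroup `P` fixes a vector `x` and a linear form not vanishing at `x`, then every
subgroup `Q` from which the module is relatively projective contains a conjugate of `P`. -/
theorem IsSummandOfInduced.exists_le_conj [Finite G] {p : ℕ} [Fact p.Prime] [CharP F p]
    {V : Type w} [AddCommGroup V] [Module F V] {ρ : Representation F G V} {Q : Subgroup G}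
    (h : IsSummandOfInduced ρ Q) {P : Subgroup G} (hP : IsPGroup p P) (x : V) (f : V →ₗ[F] F)
    (hx : ∀ g ∈ P, ρ g x = x) (hf : ∀ g ∈ P, ∀ v, f (ρ g v) = f v) (hfx : f x ≠ 0) :
    ∃ g : G, P ≤ Q.map (MulAut.conj g : G ≃* G).toMonoidHom := by
  classical
  obtain ⟨N, _, _, σ, -, -, i, r, hir⟩ := h
  have := Fintype.ofFinite (G ⧸ Q)
  -- `π y` projects onto one block. The element `⟦h ⊗ₜ n⟧` determines only the coset `Qh`, and
  -- inversion turns this into the left coset of `h⁻¹`, on which `G` acts by left translation.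
  let π (y : G ⧸ Q) : IndV Q.subtype σ →ₗ[F] IndV Q.subtype σ :=
    IndV.lift _ _ (fun h => if ((h⁻¹ : G) : G ⧸ Q) = y then IndV.mk _ σ h else 0) fun q h n => by
      have : (((Q.subtype q * h)⁻¹ : G) : G ⧸ Q) = (h⁻¹ : G) := by
        rw [eq_comm, QuotientGroup.eq]
        simp
      rw [this]
      split_ifs
      · exact IndV.mk_map_mul _ _ _ _ _
      · rfl
  have hπ_mk (y : G ⧸ Q) (h : G) (n : N) : π y (IndV.mk _ σ h n) =
      if ((h⁻¹ : G) : G ⧸ Q) = y then IndV.mk _ σ h n else 0 := by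
    rw [IndV.lift_mk]
    split_ifs <;> rfl
  have hπ : ∑ y, π y = LinearMap.id := IndV.hom_ext_apply fun h n => by
    rw [LinearMap.sum_apply, Finset.sum_congr rfl fun y _ => hπ_mk y h n,
      Finset.sum_ite_eq, if_pos (Finset.mem_univ _), LinearMap.id_apply]
  have hπg (g : G) (y : G ⧸ Q) (w) :
      π (g • y) (ind Q.subtype σ g w) = ind Q.subtype σ g (π y w) := by
    suffices π (g • y) ∘ₗ ind Q.subtype σ g = ind Q.subtype σ g ∘ₗ π y from
      LinearMap.congr_fun this w
    refine IndV.hom_ext_apply fun h n => ?_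
    change π (g • y) (ind _ σ g (IndV.mk _ σ h n)) = ind _ σ g (π y (IndV.mk _ σ h n))
    have : (((h * g⁻¹)⁻¹ : G) : G ⧸ Q) = g • ((h⁻¹ : G) : G ⧸ Q) := by simp
    simp only [ind_mk, hπ_mk, this, smul_left_cancel_iff]
    split_ifs
    · rw [ind_mk]
    · rw [map_zero]
  let c (y : G ⧸ Q) : F := f (r (π y (i x)))
  have hc (g : P) (y : G ⧸ Q) : c (g • y) = c y := by
    have h1 : i x = ind Q.subtype σ g (i x) := by
      rw [← i.isIntertwining, hx g g.2]
    change f (r (π ((g : G) • y) (i x))) = _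
    rw [h1, hπg, r.isIntertwining, hf g g.2]
  have hsum : ∑ y, c y = f x := by
    simp only [c]
    rw [← map_sum, ← map_sum, ← LinearMap.sum_apply, hπ, LinearMap.id_apply, hir]
  have hne : (MulAction.fixedPoints P (G ⧸ Q)).Nonempty := by
    by_contra h
    rw [Set.not_nonempty_iff_eq_empty] at h
    exact hfx (hsum ▸ hP.sum_eq_zero_of_fixedPoints_eq_empty c hc h)
  obtain ⟨y, hy⟩ := hne
  obtain ⟨g, rfl⟩ := QuotientGroup.mk_surjective y
  -- A coset `gQ` fixed by `P` means `g⁻¹Pg ≤ Q`.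
  refine ⟨g, fun q hq => ⟨g⁻¹ * q * g, ?_, by simp [mul_assoc]⟩⟩
  have := hy ⟨q, hq⟩
  change ((q * g : G) : G ⧸ Q) = g at this
  rw [eq_comm, QuotientGroup.eq] at this
  simpa [mul_assoc] using this

/-- A candidate below the conjugate of `Q` is conjugated back below `Q`, where minimality applies.
-/
theorem IsVertex.conj {V : Type w} [AddCommGroup V] [Module F V]
    {ρ : Representation F G V} {Q : Subgroup G} (h : IsVertex ρ Q) (g : G) :
    IsVertex ρ (Q.map (MulAut.conj g : G ≃* G).toMonoidHom) := by
  refine ⟨h.1.conj g, fun R hR hRQ => ?_⟩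
  have hcomp (g : G) : (MulAut.conj g⁻¹ : G ≃* G).toMonoidHom.comp
      (MulAut.conj g : G ≃* G).toMonoidHom = MonoidHom.id G := by
    ext; simp [mul_assoc]
  have h1 : R.map (MulAut.conj g⁻¹ : G ≃* G).toMonoidHom ≤ Q := by
    refine (Subgroup.map_mono hRQ).trans ?_
    rw [Subgroup.map_map, hcomp, Subgroup.map_id]
  have h2 := Subgroup.map_mono (f := (MulAut.conj g : G ≃* G).toMonoidHom)
    (h.2 (hR.conj g⁻¹) h1)
  rwa [Subgroup.map_map, show (MulAut.conj g : G ≃* G).toMonoidHom.comp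
    (MulAut.conj g⁻¹ : G ≃* G).toMonoidHom = MonoidHom.id G by simpa using hcomp g⁻¹,
    Subgroup.map_id] at h2

theorem exists_isVertex_ge [Finite G] {p : ℕ} [Fact p.Prime] [CharP F p]
    {V : Type u} [AddCommGroup V] [Module F V] [Module.Finite F V] {ρ : Representation F G V}
    (hρ : IsIndecomposable ρ) {P : Subgroup G} (hP : IsPGroup p P) (x : V) (f : V →ₗ[F] F)
    (hx : ∀ g ∈ P, ρ g x = x) (hf : ∀ g ∈ P, ∀ v, f (ρ g v) = f v) (hfx : f x ≠ 0) :
    ∃ Q : Subgroup G, IsVertex ρ Q ∧ P ≤ Q := by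
  obtain ⟨Q, -, hQ⟩ := exists_minimal_le_of_wellFoundedLT (IsSummandOfInduced ρ) ⊤
    (isSummandOfInduced_top hρ)
  obtain ⟨g, hg⟩ := hQ.1.exists_le_conj hP x f hx hf hfx
  exact ⟨_, IsVertex.conj hQ g, hg⟩

end GreenVertex

/-! ### A polytabloid and a linear form fixed by permutations of `A` -/

namespace SpechtModule

variable {lam : YoungDiagram}

/-- There is a tableau with the entries of `A` in boxes that are alone in their columns. -/
theorem exists_tableau_rowLen_one_le_col (A : Finset (Fin lam.card))
    (hA : A.card = lam.rowLen 0 - lam.rowLen 1) :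
    ∃ t : Tableau lam, ∀ a ∈ A, lam.rowLen 1 ≤ t.col a := by
  classical
  have e : lam.cells ≃ Fin lam.card := lam.cells.equivFin
  -- These boxes all lie in the first row, so there are `lam.rowLen 0 - lam.rowLen 1` of them.
  let B : Finset lam.cells := Finset.univ.filter fun c => lam.rowLen 1 ≤ c.1.2
  have hB : B.card = A.card := by
    rw [hA, ← Nat.card_Ico]
    have hrow (c : lam.cells) (hc : c ∈ B) : c.1.1 = 0 ∧ c.1.2 < lam.rowLen 0 := by
      have h1 : c.1.2 < lam.rowLen c.1.1 := YoungDiagram.mem_iff_lt_rowLen.1 c.2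
      have h2 : lam.rowLen 1 ≤ c.1.2 := (Finset.mem_filter.1 hc).2
      have h3 : c.1.1 = 0 := by
        by_contra h
        have := lam.rowLen_anti 1 c.1.1 (by omega)
        omega
      exact ⟨h3, h3 ▸ h1⟩
    refine Finset.card_bij (fun c _ => c.1.2) (fun c hc => ?_) (fun c hc d hd h => ?_)
      fun j hj => ?_
    · exact Finset.mem_Ico.2 ⟨(Finset.mem_filter.1 hc).2, (hrow c hc).2⟩
    · exact Subtype.ext (Prod.ext ((hrow c hc).1.trans (hrow d hd).1.symm) h)
    · rw [Finset.mem_Ico] at hj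
      exact ⟨⟨(0, j), YoungDiagram.mem_iff_lt_rowLen.2 hj.2⟩,
        Finset.mem_filter.2 ⟨Finset.mem_univ _, hj.1⟩, rfl⟩
  obtain ⟨τ, hτ⟩ := Equiv.Perm.exists_map_finset_eq (B.map e.toEmbedding) A (by simpa using hB)
  refine ⟨e.trans τ, fun a ha => ?_⟩
  rw [← hτ] at ha
  simp only [Finset.mem_map] at ha
  obtain ⟨_, ⟨c, hc, rfl⟩, rfl⟩ := ha
  have : c ∈ B := hc
  simp only [B, Finset.mem_filter] at this
  simpa [Tableau.col] using this.2

theorem Tableau.mem_cells (t : Tableau lam) (a : Fin lam.card) :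
    (t.row a, t.col a) ∈ lam :=
  (Equiv.symm t a).2

theorem Tableau.eq_of_row_eq_of_col_eq (t : Tableau lam) {a b : Fin lam.card}
    (hr : t.row a = t.row b) (hc : t.col a = t.col b) : a = b :=
  (Equiv.symm t).injective (Subtype.ext (Prod.ext hr hc))

theorem Tableau.row_eq_zero (t : Tableau lam) {a : Fin lam.card}
    (ha : lam.rowLen 1 ≤ t.col a) : t.row a = 0 := by
  by_contra h
  have h1 := YoungDiagram.mem_iff_lt_rowLen.1 (t.mem_cells a)
  have h2 := lam.rowLen_anti 1 (t.row a) (by omega)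
  omega

theorem eq_one_of_mem_colStabilizer {t : Tableau lam} {g : Equiv.Perm (Fin lam.card)}
    (hg : g ∈ colStabilizer t) (h : g • t.tabloid = t.tabloid) : g = 1 := by
  have h : (g • t).row = t.row := Quotient.exact h
  ext1 a
  refine t.eq_of_row_eq_of_col_eq ?_ (hg a)
  simpa [row_smul] using (congrFun h (g a)).symm

variable (F : Type u) [Field F]

/-- Only `g = 1` contributes: an element of `C(t)` fixing the tabloid preserves both the row and the
column of every entry. -/
theorem coeff_polytabloid_self (t : Tableau lam) :
    (polytabloid F t).coeff t.tabloid = 1 := by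
  classical
  rw [polytabloid, MonoidAlgebra.coeff_sum, Finsupp.finsetSum_apply, Finset.sum_eq_single 1]
  · simp
  · intro g hg hg1
    have : g • t.tabloid ≠ t.tabloid := fun h =>
      hg1 (eq_one_of_mem_colStabilizer (by simpa using hg) h)
    simp [this]
  · intro h
    exact absurd (Finset.mem_filter.2 ⟨Finset.mem_univ _, one_mem (colStabilizer t)⟩) h

/-- A permutation that fixes the tabloid of `t` and commutes with `C(t)` fixes the polytabloid
`e_t`. -/
theorem youngPermRep_polytabloid_eq_self {t : Tableau lam} {s : Equiv.Perm (Fin lam.card)}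
    (hs : s • t.tabloid = t.tabloid) (hc : ∀ g ∈ colStabilizer t, Commute s g) :
    youngPermRep F lam s (polytabloid F t) = polytabloid F t := by
  rw [polytabloid, map_sum]
  refine Finset.sum_congr rfl fun g hg => ?_
  rw [Representation.ofMulAction_single, ← mul_smul, (hc g (by simpa using hg)).eq, mul_smul, hs]

variable {A : Finset (Fin lam.card)} {t : Tableau lam}

theorem ofSubtype_smul_tabloid (ht : ∀ a ∈ A, lam.rowLen 1 ≤ t.col a) (s : Equiv.Perm A) :
    Equiv.Perm.ofSubtype s • t.tabloid = t.tabloid := by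
  refine Quotient.sound (funext fun a => ?_ : (Equiv.Perm.ofSubtype s • t).row = t.row)
  rw [row_smul, ← map_inv]
  by_cases ha : a ∈ A
  · rw [Equiv.Perm.ofSubtype_apply_of_mem _ ha, t.row_eq_zero (ht a ha),
      t.row_eq_zero (ht _ (s⁻¹ ⟨a, ha⟩).2)]
  · rw [Equiv.Perm.ofSubtype_apply_of_not_mem _ ha]

/-- The supports are disjoint: an element of `C(t)` fixes every entry of `A`, since it is alone in
its column. -/
theorem commute_ofSubtype_of_mem_colStabilizer (ht : ∀ a ∈ A, lam.rowLen 1 ≤ t.col a)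
    (s : Equiv.Perm A) {g : Equiv.Perm (Fin lam.card)} (hg : g ∈ colStabilizer t) :
    Commute (Equiv.Perm.ofSubtype s) g := by
  refine Equiv.Perm.Disjoint.commute fun a => ?_
  by_cases ha : a ∈ A
  · right
    have h := ht a ha
    refine t.eq_of_row_eq_of_col_eq ?_ (hg a)
    rw [t.row_eq_zero h, t.row_eq_zero ((hg a).symm ▸ h)]
  · exact Or.inl (Equiv.Perm.ofSubtype_apply_of_not_mem _ ha)

instance : Finite (Tableau lam) := inferInstanceAs (Finite (lam.cells ≃ Fin lam.card))

end SpechtModule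

theorem corollary1p2 (p : ℕ) [Fact p.Prime] (F : Type u) [Field F] [CharP F p]
    (lam : YoungDiagram)
    (hind : GreenVertex.IsIndecomposable (SpechtModule.spechtRep F lam))
    (A : Finset (Fin lam.card)) (hA : A.card = lam.rowLen 0 - lam.rowLen 1)
    (P : Sylow p (Equiv.Perm A)) :
    ∃ Q : Subgroup (Equiv.Perm (Fin lam.card)),
      GreenVertex.IsVertex (SpechtModule.spechtRep F lam) Q ∧
      Subgroup.map (Equiv.Perm.ofSubtype : Equiv.Perm A →* Equiv.Perm (Fin lam.card))
        (P : Subgroup (Equiv.Perm A)) ≤ Q := by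
  open SpechtModule in
  obtain ⟨t, ht⟩ := exists_tableau_rowLen_one_le_col A hA
  have : Module.Finite F (specht F lam).toSubmodule :=
    Module.Finite.iff_fg.2 (Submodule.fg_span (Set.finite_range _))
  let f : (specht F lam).toSubmodule →ₗ[F] F :=
    Finsupp.lapply t.tabloid ∘ₗ (MonoidAlgebra.coeffLinearEquiv F).toLinearMap ∘ₗ
      (specht F lam).toSubmodule.subtype
  refine GreenVertex.exists_isVertex_ge hind (P.2.map _)
    ⟨polytabloid F t, Submodule.subset_span ⟨t, rfl⟩⟩ f ?_ ?_ ?_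
  · rintro _ ⟨s, -, rfl⟩
    exact Subtype.ext (youngPermRep_polytabloid_eq_self F (ofSubtype_smul_tabloid ht s)
      fun g hg => commute_ofSubtype_of_mem_colStabilizer ht s hg)
  · rintro _ ⟨s, -, rfl⟩ v
    change (youngPermRep F lam _ v.1).coeff t.tabloid = v.1.coeff t.tabloid
    -- The coefficient of a translate by `s` is the coefficient at the tabloid moved by `s⁻¹`, which
    -- is the same tabloid.
    rw [Representation.coeff_ofMulAction, ← map_inv, ofSubtype_smul_tabloid ht]
  · change (polytabloid F t).coeff t.tabloid ≠ 0
    rw [coeff_polytabloid_self]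
    exact one_ne_zero
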